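/- **Setting.** There are $n$ arms. Arm $a$ has a known point $p_a\in\mathbb R$ and an unknown law on $[0,1]^d$ with mean (weight) $\mu_a\in[0,1]^d$; each draw from an arm gives an independent sample of its law. A finite family of intervals $I=[\ell,r]$, $\ell<r$, is given, and $\mathcal A(I)=\{a:\ \ell\le p_a\le r\}$. A set $S\subseteq\mathcal A(I)$ is *$\varepsilon$-Pareto optimal for $I$* if for every $b\in\mathcal A(I)$ there is $a\in S$ with $\mu_a\ge\mu_b-\varepsilon\mathbf 1$, and for no $a\in S$ is there $b\in\mathcal A(I)$ with $\mu_b\ge\mu_a+\varepsilon\mathbf 1$ (componentwise). An algorithm samples arms adaptively, possibly using private randomness, and stops at a time of its choice with an output. On a given input (points and intervals) it is *$(\varepsilon,\delta)$-PAC* if, whatever the laws of the arms, with probability at least $1-\delta$ it outputs an $\varepsilon$-Pareto optimal set for every given interval. Arm $a$ *$\varepsilon$-dominates* arm $b$ if $\mu_a\ge\mu_b-\varepsilon\mathbf 1$. **Theorem.** There is an absolute constant $C>0$ such that the following holds for all integers $d\ge1$ and $m\ge2$, all $\varepsilon>0$ such that $\frac1{8\varepsilon}$ is an integer that is at least $2$,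 and all $0<\delta\le\frac12$. Let $T_1=\left(\frac1{8\varepsilon}\right)^d$, and consider the input with $n_1=mT_1$ arms in $T_1$ groups $A_1,\dots,A_{T_1}$ of $m$ arms each, where every arm of $A_t$ has the point $t$, and with the intervals $I_t=[0,t]$, $1\le t\le T_1$. For every algorithm that is $(\varepsilon,\delta)$-PAC on this input there are laws of the arms under which the expected number of samples that it draws is at least $$C\,\frac{n_1}{\varepsilon^2}\,\log\frac1{\varepsilon^d\delta}.$$ Thus any algorithm with the $(\varepsilon,\delta)$-PAC guarantee for $d$-dimensional weights has (worst-case) sample complexity $\Omega\left(\frac{n_1}{\varepsilon^2}\log\frac1{\varepsilon^d\delta}\right)$. Moreover these laws can be chosen so that the weights are encoded by digits: if $k_1k_2\dots k_d$ is the base-$\frac1{8\varepsilon}$ representation of $t-1$ with $d$ digits, the weight of the $j$-th arm of $A_t$ is $(s_{t,j}+4\varepsilon k_1,\dots,s_{t,j}+4\varepsilon k_d)$ with $\frac14\le s_{t,j}\le\frac14+4\varepsilon$; each group $A_t$ has a best arm whose $s$-value exceeds that of every other arm of $A_t$ by more than $\varepsilon$; and no arm of an earlier group $\varepsilon$-dominates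 the best arm of a later group. -/

import Mathlib

open MeasureTheory
open scoped ENNReal

universe u

namespace RangeSearch

/-- The known part of a bandit range searching instance: every arm sits at a point of the real line,
and every query is an interval `[left, right]` with non-empty interior. -/
structure RangeInput (A Q : Type) where
  point : A → ℝ
  left : Q → ℝ
  right : Q → ℝ
  left_lt_right : ∀ I, left I < right I

/-- The arms whose point lies in the interval `I`. -/
def RangeInput.arms {A Q : Type} (inp : RangeInput A Q) (I : Q) : Set A :=
  {a | inp.left I ≤ inp.point a ∧ inp.point a ≤ inp.right I}

/-- The unknown part of an instance: a sample from the arm `a` is a random vector in `[0,1]^d`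
with law `law a`. -/
structure RewardModel (A : Type) (d : ℕ) where
  law : A → Measure (Fin d → ℝ)
  isProb : ∀ a, IsProbabilityMeasure (law a)
  supported : ∀ a, ∀ᵐ x ∂(law a), ∀ i, x i ∈ Set.Icc (0 : ℝ) 1

/-- The weight of an arm: the mean vector of its law. -/
noncomputable def RewardModel.weight {A : Type} {d : ℕ} (R : RewardModel A d) (a : A) :
    Fin d → ℝ :=
  fun i => ∫ x, x i ∂(R.law a)

/-- The arm `a` `ε`-dominates the arm `b`: `μ a ≥ μ b - ε 𝟙` componentwise. -/
def EpsDominates {A : Type} {d : ℕ} (μ : A → Fin d → ℝ) (ε : ℝ) (a b : A) : Prop :=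
  ∀ i, μ b i - ε ≤ μ a i

/-- `S` is an `ε`-Pareto optimal set of arms for the interval `I`, the weights being `μ`. -/
def IsEpsPareto {A Q : Type} {d : ℕ} (inp : RangeInput A Q) (μ : A → Fin d → ℝ) (ε : ℝ)
    (I : Q) (S : Finset A) : Prop :=
  (∀ a ∈ S, a ∈ inp.arms I) ∧
  (∀ b ∈ inp.arms I, ∃ a ∈ S, EpsDominates μ ε a b) ∧
  (∀ a ∈ S, ¬ ∃ b ∈ inp.arms I, ∀ i, μ a i + ε ≤ μ b i)

/-- An adaptive randomized sampling algorithm with arms `A`, samples in `ℝ^d` and outputs in `O`.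
It first draws a private random seed. From the seed and the list of all (arm, sample) pairs seen so
far, `next` decides either to sample an arm (`Sum.inl`) or to stop with an output (`Sum.inr`). -/
structure SamplingAlgorithm (A : Type) (d : ℕ) (O : Type) where
  Seed : Type u
  [seedSpace : MeasurableSpace Seed]
  seedLaw : Measure Seed
  [seedProb : IsProbabilityMeasure seedLaw]
  next : Seed → List (A × (Fin d → ℝ)) → A ⊕ O
  measurable_next : ∀ (k : ℕ) (a : Fin k → A) (r : A ⊕ O),
    MeasurableSet {z : Seed × (Fin k → Fin d → ℝ) |
      next z.1 (List.ofFn fun j => (a j, z.2 j)) = r}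

namespace SamplingAlgorithm

attribute [instance] SamplingAlgorithm.seedSpace SamplingAlgorithm.seedProb

variable {A : Type} {d : ℕ} {O : Type}

/-- The list of (arm, sample) pairs after at most `k` draws; `y (j, a)` is the value that is
observed if the draw number `j` is made from the arm `a`. The list no longer changes once the
algorithm has stopped. -/
def transcript (alg : SamplingAlgorithm.{u} A d O) (s : alg.Seed) (y : ℕ × A → Fin d → ℝ) :
    ℕ → List (A × (Fin d → ℝ))
  | 0 => []
  | k + 1 =>
    match alg.next s (transcript alg s y k) with
    | Sum.inl a => transcript alg s y k ++ [(a, y (k, a))]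
    | Sum.inr _ => transcript alg s y k

/-- The algorithm stops with the output `o`. -/
def Outputs (alg : SamplingAlgorithm.{u} A d O) (s : alg.Seed) (y : ℕ × A → Fin d → ℝ)
    (o : O) : Prop :=
  ∃ k, alg.next s (alg.transcript s y k) = Sum.inr o

/-- The total number of samples that are drawn (`∞` if the algorithm never stops). -/
noncomputable def numSamples (alg : SamplingAlgorithm.{u} A d O) (s : alg.Seed)
    (y : ℕ × A → Fin d → ℝ) : ℝ≥0∞ :=
  ⨆ k, ((alg.transcript s y k).length : ℝ≥0∞)

/-- The joint law of the seed and of the table of samples: all entries of the table are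
independent of each other and of the seed, and the entry `(j, a)` has the law of the arm `a`. -/
noncomputable def runLaw (alg : SamplingAlgorithm.{u} A d O) (R : RewardModel A d) :
    Measure (alg.Seed × (ℕ × A → Fin d → ℝ)) :=
  haveI : ∀ p : ℕ × A, IsProbabilityMeasure (R.law p.2) := fun p => R.isProb p.2
  alg.seedLaw.prod (Measure.infinitePi fun p : ℕ × A => R.law p.2)

/-- The expected number of samples that the algorithm draws when the arms follow `R`. -/
noncomputable def expectedSamples (alg : SamplingAlgorithm.{u} A d O) (R : RewardModel A d) :
    ℝ≥0∞ :=
  ∫⁻ ω, alg.numSamples ω.1 ω.2 ∂(alg.runLaw R)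

/-- The `(ε, δ)`-PAC guarantee on the input `inp`: whatever the laws of the arms are, with
probability at least `1 - δ` the algorithm stops and outputs, for every interval of the input, an
`ε`-Pareto optimal set of arms. -/
def AchievesPAC {Q : Type} (alg : SamplingAlgorithm.{u} A d (Q → Finset A))
    (inp : RangeInput A Q) (ε δ : ℝ) : Prop :=
  ∀ R : RewardModel A d,
    ENNReal.ofReal (1 - δ) ≤ alg.runLaw R
      {ω | ∃ o, alg.Outputs ω.1 ω.2 o ∧ ∀ I, IsEpsPareto inp R.weight ε I (o I)}

end SamplingAlgorithm

/-- The single-copy input with `T` groups of `m` arms. Groups are numbered from `0` here: the arms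
`(t, _)` sit at the point `t + 1`, and the interval number `t` is `[0, t + 1]`. -/
def singleCopy (T m : ℕ) : RangeInput (Fin T × Fin m) (Fin T) where
  point a := (a.1 : ℝ) + 1
  left _ := 0
  right t := (t : ℝ) + 1
  left_lt_right t := by positivity

/-- The digit number `i` (counted from `0`, the most significant one first) of the base-`B`
representation of `t` with `d` digits. -/
def digit (B d t : ℕ) (i : Fin d) : ℕ := t / B ^ (d - 1 - (i : ℕ)) % B

end RangeSearch

namespace RangeSearch

open ProbabilityTheory

/-! The lower bound is a change-of-measure argument over a family of hard instances indexed by `θ`,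
which names the best arm of every group. Each sample is driven by one coin. The arm `0` of a group
has excess `3ε/2`, the arm `θ t` has excess `3ε` if it is not `0`, and every other coin is fair.
Digit encoding stops earlier groups from `ε`-dominating the best arm of a later one, so a correct
output must contain the best arm of each group and no other arm of that group
(`mem_iff_of_isEpsPareto`). It therefore determines `θ`.

If `θ t = 0`, making `j ≠ 0` the best arm of group `t` alters a single fair coin, and its divergence
is `O(ε²)`. The transport inequality `transport_le` bounds the expected number of tosses of that
coin from below when the event "the output reveals `θ`" is likely under `θ` and rare under the
altered instance. Summing over all such `(t, j)` bounds the expected total number of samples.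

The factor `log (T / δ)`, with `T = B ^ d`, instead of `log (1 / δ)` comes from averaging. In a
fixed instance `θ'` the events of revealing the different instances obtained by resetting one group
to `0` are disjoint from each other and from the correct event, so their probabilities sum to at
most `δ` (`sum_update_zero_le`). Under a product prior the typical probability of the wrong event is
thus of order `δ / T`. The transport inequality is kept linear in this probability, by a tangent to
the logarithm, so that it can be averaged (`averaged_transport_le`). The tangent point and the
weight `K` are optimized in `mul_log_le_of_expectedSamples_le`. -/

/-- The law of a coin that shows `true` with probability `p`. -/
noncomputable def coin (p : unitInterval) : Measure Bool :=
  ENNReal.ofReal p • Measure.dirac true + ENNReal.ofReal (1 - p) • Measure.dirac false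

instance (p : unitInterval) : IsProbabilityMeasure (coin p) := by
  constructor
  have h := p.2
  simp only [coin, Measure.add_apply, Measure.smul_apply, measure_univ, smul_eq_mul, mul_one]
  rw [← ENNReal.ofReal_add h.1 (by linarith [h.2])]
  simp

theorem integral_coin (p : unitInterval) (f : Bool → ℝ) :
    ∫ x, f x ∂(coin p) = p * f true + (1 - p) * f false := by
  have h := p.2
  have : IsFiniteMeasure (ENNReal.ofReal (p : ℝ) • Measure.dirac true) :=
    Measure.smul_finite _ ENNReal.ofReal_ne_top
  have : IsFiniteMeasure (ENNReal.ofReal (1 - (p : ℝ)) • Measure.dirac false) :=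
    Measure.smul_finite _ ENNReal.ofReal_ne_top
  rw [coin, integral_add_measure .of_finite .of_finite, integral_smul_measure, integral_smul_measure, integral_dirac, integral_dirac,
    ENNReal.toReal_ofReal h.1, ENNReal.toReal_ofReal (by linarith [h.2])]
  simp

/-- The law of a table of independent coins, the entry `(k, a)` having bias `p a`. -/
noncomputable def coinTable {A : Type*} (p : A → unitInterval) : Measure (ℕ × A → Bool) :=
  Measure.infinitePi fun q => coin (p q.2)

instance {A : Type*} (p : A → unitInterval) : IsProbabilityMeasure (coinTable p) := by
  unfold coinTable; infer_instance

/-! ### Change of measure for deterministic adaptive coin tossing. -/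

section CoinAlgorithm

variable {A O : Type*} (nx : List (A × Bool) → A ⊕ O)

/-- The observations of a deterministic strategy `nx` after at most `k` coin tosses. -/
def coinTranscript (b : ℕ × A → Bool) : ℕ → List (A × Bool)
  | 0 => []
  | k + 1 =>
    match nx (coinTranscript b k) with
    | Sum.inl a => coinTranscript b k ++ [(a, b (k, a))]
    | Sum.inr _ => coinTranscript b k

/-- Step `i` reads only row `i` of the table. So the transcript after `k` steps is a function of
finitely many coins and is independent of row `k`, which gives measurability, integrability and the
factorization in `integral_mul_coin`. -/
theorem coinTranscript_congr {b b' : ℕ × A → Bool} {k : ℕ}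
    (h : ∀ i < k, ∀ a, b (i, a) = b' (i, a)) :
    coinTranscript nx b k = coinTranscript nx b' k := by
  induction k with
  | zero => rfl
  | succ k ih =>
    simp only [coinTranscript]
    rw [ih fun i hi a => h i (by omega) a]
    split
    · rw [h k (by omega)]
    · rfl

/-- The likelihood ratio of a transcript, `r a x` being that of the outcome `x` of the coin `a`. -/
def likelihoodRatio (r : A → Bool → ℝ) (l : List (A × Bool)) : ℝ :=
  (l.map fun q => r q.1 q.2).prod

theorem likelihoodRatio_pos {r : A → Bool → ℝ} (hr : ∀ a x, 0 < r a x) (l : List (A × Bool)) :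
    0 < likelihoodRatio r l :=
  List.prod_pos fun x hx => by
    obtain ⟨q, -, rfl⟩ := List.mem_map.1 hx
    exact hr _ _

variable [Fintype A]

/-- The rows before row `k` of a table of coins. -/
def earlierRows (A : Type*) [Fintype A] (k : ℕ) : Finset (ℕ × A) :=
  Finset.range k ×ˢ Finset.univ

open Classical in
/-- The transcript as a function of the finitely many coins it depends on. -/
noncomputable def rowsTranscript (k : ℕ) (c : earlierRows A k → Bool) : List (A × Bool) :=
  -- The default `false` is never read during the first `k` steps.
  coinTranscript nx (fun q => if h : q ∈ earlierRows A k then c ⟨q, h⟩ else false) k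

theorem rowsTranscript_restrict (k : ℕ) (b : ℕ × A → Bool) :
    rowsTranscript nx k (fun q => b q) = coinTranscript nx b k := by
  refine coinTranscript_congr nx fun i hi a => ?_
  simp [earlierRows, hi]

theorem measurable_comp_coinTranscript {β : Type*} [MeasurableSpace β] (f : List (A × Bool) → β)
    (k : ℕ) : Measurable fun b => f (coinTranscript nx b k) := by
  have h : (fun b => f (coinTranscript nx b k)) =
      (f ∘ rowsTranscript nx k) ∘ fun (b : ℕ × A → Bool) (q : earlierRows A k) => b q := by
    funext b
    simp [rowsTranscript_restrict]
  rw [h]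
  exact (measurable_of_countable _).comp (by fun_prop)

theorem integrable_comp_coinTranscript (p : A → unitInterval) (f : List (A × Bool) → ℝ) (k : ℕ) :
    Integrable (fun b => f (coinTranscript nx b k)) (coinTable p) := by
  have h : (fun b => f (coinTranscript nx b k)) =
      (f ∘ rowsTranscript nx k) ∘ fun (b : ℕ × A → Bool) (q : earlierRows A k) => b q := by
    funext b
    simp [rowsTranscript_restrict]
  rw [h]
  have hm : Measurable fun (b : ℕ × A → Bool) (q : earlierRows A k) => b q := by fun_prop
  have := Measure.isProbabilityMeasure_map (μ := coinTable p) hm.aemeasurable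
  exact Integrable.comp_measurable .of_finite hm

theorem integral_mul_coin (p : A → unitInterval) (f : List (A × Bool) → ℝ) (g : Bool → ℝ)
    (k : ℕ) (a : A) :
    ∫ b, f (coinTranscript nx b k) * g (b (k, a)) ∂(coinTable p) =
      (∫ b, f (coinTranscript nx b k) ∂(coinTable p)) * (p a * g true + (1 - p a) * g false) := by
  have hI : iIndepFun (fun (q : ℕ × A) (b : ℕ × A → Bool) => b q) (coinTable p) :=
    iIndepFun_infinitePi (P := fun q : ℕ × A => coin (p q.2)) (X := fun _ x => x)
      (fun _ => measurable_id)
  have h2 := hI.indepFun_finset (earlierRows A k) {(k, a)} (by simp [earlierRows])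
    (fun _ => by fun_prop)
  have h3 := h2.comp (φ := f ∘ rowsTranscript nx k)
    (ψ := fun c : ({(k, a)} : Finset (ℕ × A)) → Bool => g (c ⟨(k, a), by simp⟩))
    (measurable_of_countable _) (measurable_of_countable _)
  have h4 := h3.integral_fun_mul_eq_mul_integral
    ((measurable_of_countable (f ∘ rowsTranscript nx k)).comp
      (by fun_prop)).aestronglyMeasurable
    ((measurable_of_countable _).comp (by fun_prop)).aestronglyMeasurable
  simp only [Function.comp_apply, rowsTranscript_restrict] at h4
  rw [h4]
  congr 1
  have h5 : (coinTable p).map (fun b => b (k, a)) = coin (p a) :=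
    Measure.infinitePi_map_eval (fun q : ℕ × A => coin (p q.2)) (k, a)
  rw [← integral_coin, ← h5, integral_map (measurable_pi_apply (k, a)).aemeasurable
    (measurable_of_countable _).aestronglyMeasurable]

/-- The conditional mean of `g` after one more step of the strategy. -/
noncomputable def stepMean (p : A → unitInterval) (g : List (A × Bool) → ℝ)
    (l : List (A × Bool)) : ℝ :=
  match nx l with
  | Sum.inl a => p a * g (l ++ [(a, true)]) + (1 - p a) * g (l ++ [(a, false)])
  | Sum.inr _ => g l

theorem integral_coinTranscript_succ (p : A → unitInterval) (g : List (A × Bool) → ℝ) (k : ℕ) :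
    ∫ b, g (coinTranscript nx b (k + 1)) ∂(coinTable p) =
      ∫ b, stepMean nx p g (coinTranscript nx b k) ∂(coinTable p) := by
  classical
  -- Splitting by the next arm and its outcome makes each term a function of the past times a
  -- function of one fresh coin; `v` collects the stopped case.
  let u : A → Bool → List (A × Bool) → ℝ := fun a x l =>
    if nx l = Sum.inl a then g (l ++ [(a, x)]) else 0
  let v : List (A × Bool) → ℝ := fun l => if (nx l).isRight then g l else 0
  have h1 : ∀ b, g (coinTranscript nx b (k + 1)) = v (coinTranscript nx b k) +
      ∑ a, (u a true (coinTranscript nx b k) * (if b (k, a) then 1 else 0) +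
        u a false (coinTranscript nx b k) * (if b (k, a) then 0 else 1)) := by
    intro b
    simp only [coinTranscript, u, v]
    rcases h : nx (coinTranscript nx b k) with a | o
    · rw [Finset.sum_eq_single a]
      · cases h' : b (k, a) <;> simp [h']
      · intro a' _ h'
        simp [h'.symm]
      · simp
    · simp
  have h2 : ∀ l, stepMean nx p g l = v l + ∑ a, (u a true l * (p a * 1 + (1 - p a) * 0) +
      u a false l * (p a * 0 + (1 - p a) * 1)) := by
    intro l
    simp only [stepMean, u, v]
    rcases h : nx l with a | o
    · rw [Finset.sum_eq_single a]
      · simp; ring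
      · intro a' _ h'
        simp [h'.symm]
      · simp
    · simp
  have hg : ∀ (a : A) (x : Bool) (w : Bool → ℝ), Integrable
      (fun b => u a x (coinTranscript nx b k) * w (b (k, a))) (coinTable p) := by
    intro a x w
    refine (integrable_comp_coinTranscript nx p (u a x) k).mul_bdd (c := max |w true| |w false|)
      ((measurable_of_countable w).comp (by fun_prop)).aestronglyMeasurable
      (Filter.Eventually.of_forall fun b => ?_)
    cases b (k, a) <;> simp
  simp only [h1, h2]
  have hg1 := fun a => hg a true (fun x => if x then 1 else 0)
  have hg0 := fun a => hg a false (fun x => if x then 0 else 1)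
  have hc : ∀ (a : A) (x : Bool) (r : ℝ), Integrable
      (fun b => u a x (coinTranscript nx b k) * r) (coinTable p) := fun a x r =>
    (integrable_comp_coinTranscript nx p (u a x) k).mul_const r
  have split : ∀ F G : A → (ℕ × A → Bool) → ℝ, (∀ a, Integrable (F a) (coinTable p)) →
      (∀ a, Integrable (G a) (coinTable p)) →
      ∫ b, (v (coinTranscript nx b k) + ∑ a, (F a b + G a b)) ∂(coinTable p) =
        ∫ b, v (coinTranscript nx b k) ∂(coinTable p) +
          ∑ a, (∫ b, F a b ∂(coinTable p) + ∫ b, G a b ∂(coinTable p)) := by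
    intro F G hF hG
    have hFG : ∀ a, Integrable (fun b => F a b + G a b) (coinTable p) := fun a =>
      (hF a).add (hG a)
    rw [integral_add (integrable_comp_coinTranscript nx p v k)
      (integrable_finsetSum _ fun a _ => hFG a), integral_finsetSum _ fun a _ => hFG a]
    congr 1
    exact Finset.sum_congr rfl fun a _ => integral_add (hF a) (hG a)
  rw [split _ _ hg1 hg0, split _ _ (fun a => hc a true _) fun a => hc a false _]
  congr 1
  refine Finset.sum_congr rfl fun a _ => ?_
  rw [integral_mul_const, integral_mul_const,
    integral_mul_coin nx p (u a true) (fun x => if x then 1 else 0),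
    integral_mul_coin nx p (u a false) (fun x => if x then 0 else 1)]
  simp

/-- Induction on the step, for all `g` at once: one step under `p'` is one step under `p` with the
new outcome weighted by its ratio `r`, and a stopped strategy adds no factor. -/
theorem integral_change_measure (p p' : A → unitInterval) (r : A → Bool → ℝ)
    (ht : ∀ a, (p' a : ℝ) = r a true * p a) (hf : ∀ a, 1 - (p' a : ℝ) = r a false * (1 - p a))
    (g : List (A × Bool) → ℝ) (k : ℕ) :
    ∫ b, g (coinTranscript nx b k) ∂(coinTable p') =
      ∫ b, likelihoodRatio r (coinTranscript nx b k) * g (coinTranscript nx b k)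
        ∂(coinTable p) := by
  induction k generalizing g with
  | zero => simp [coinTranscript, likelihoodRatio]
  | succ k ih =>
    rw [integral_coinTranscript_succ, ih,
      integral_coinTranscript_succ nx p fun l => likelihoodRatio r l * g l]
    congr 1
    funext b
    simp only [stepMean]
    split
    · rw [hf, ht]
      simp only [likelihoodRatio, List.map_append, List.prod_append, List.map_cons, List.map_nil,
        List.prod_cons, List.prod_nil]
      ring
    · rfl

/-- A Wald identity: `κ a` is minus the mean log-ratio of one toss of `a`, so the log-likelihood
ratio plus the accumulated `κ` is a martingale started at zero. -/
theorem integral_log_likelihoodRatio (p : A → unitInterval) (r : A → Bool → ℝ)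
    (hr : ∀ a x, 0 < r a x) (κ : A → ℝ)
    (hκ : ∀ a, κ a = -(p a * Real.log (r a true) + (1 - p a) * Real.log (r a false))) (k : ℕ) :
    ∫ b, Real.log (likelihoodRatio r (coinTranscript nx b k)) ∂(coinTable p) =
      -∫ b, ((coinTranscript nx b k).map fun q => κ q.1).sum ∂(coinTable p) := by
  have hlog : ∀ l : List (A × Bool), Real.log (likelihoodRatio r l) =
      (l.map fun q => Real.log (r q.1 q.2)).sum := by
    intro l
    induction l with
    | nil => simp [likelihoodRatio]
    | cons q l ih =>
      have h0 : (likelihoodRatio r l) ≠ 0 := by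
        refine List.prod_ne_zero ?_
        simp only [List.mem_map, not_exists, not_and]
        exact fun q _ => (hr _ _).ne'
      rw [List.map_cons, List.sum_cons, ← ih, ← Real.log_mul (hr _ _).ne' h0]
      simp [likelihoodRatio]
  suffices h : ∫ b, (fun l : List (A × Bool) => (l.map fun q => Real.log (r q.1 q.2)).sum +
      (l.map fun q => κ q.1).sum) (coinTranscript nx b k) ∂(coinTable p) = 0 by
    simp only [hlog]
    rw [integral_add (integrable_comp_coinTranscript nx p
        (fun l => (l.map fun q => Real.log (r q.1 q.2)).sum) k)
      (integrable_comp_coinTranscript nx p (fun l => (l.map fun q => κ q.1).sum) k)] at h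
    linarith
  induction k with
  | zero => simp [coinTranscript]
  | succ k ih =>
    rw [integral_coinTranscript_succ nx p fun l => (l.map fun q => Real.log (r q.1 q.2)).sum +
      (l.map fun q => κ q.1).sum, ← ih]
    congr 1
    funext b
    simp only [stepMean]
    split
    · simp only [List.map_append, List.sum_append, List.map_cons, List.map_nil, List.sum_cons,
        List.sum_nil, hκ]
      ring
    · rfl

/-- A transport inequality for adaptive coin tossing: an event that is likely under `p` and
unlikely under `p'` forces many informative tosses under `p`. -/
theorem transport_le (p p' : A → unitInterval) (r : A → Bool → ℝ)
    (ht : ∀ a, (p' a : ℝ) = r a true * p a) (hf : ∀ a, 1 - (p' a : ℝ) = r a false * (1 - p a))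
    (hr : ∀ a x, 0 < r a x) (κ : A → ℝ)
    (hκ : ∀ a, κ a = -(p a * Real.log (r a true) + (1 - p a) * Real.log (r a false))) (k : ℕ)
    (G : Set (List (A × Bool))) {K z : ℝ} (hK : 0 < K) (hz : 0 < z) :
    Real.log K * (coinTable p).real {b | coinTranscript nx b k ∈ G} -
        ∫ b, ((coinTranscript nx b k).map fun q => κ q.1).sum ∂(coinTable p) ≤
      Real.log z - 1 +
        (1 + (K - 1) * (coinTable p').real {b | coinTranscript nx b k ∈ G}) / z := by
  classical
  let χ : List (A × Bool) → ℝ := G.indicator 1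
  have hGm : MeasurableSet {b : ℕ × A → Bool | coinTranscript nx b k ∈ G} := by
    have := measurable_comp_coinTranscript nx (fun l => l ∈ G) k
    exact measurableSet_setOfPred.2 this
  have hreal : ∀ q : A → unitInterval, (coinTable q).real {b | coinTranscript nx b k ∈ G} =
      ∫ b, χ (coinTranscript nx b k) ∂(coinTable q) := by
    intro q
    rw [← integral_indicator_one hGm]
    rfl
  have hpt : ∀ l, Real.log K * χ l + Real.log (likelihoodRatio r l) ≤
      Real.log z - 1 + (likelihoodRatio r l * (1 + (K - 1) * χ l)) / z := by
    intro l
    have hL := likelihoodRatio_pos hr l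
    -- This is the tangent to the logarithm at `z`, used with `x` the likelihood ratio times `K` on
    -- `G` and times `1` off `G`. Its integral under `p` is a Donsker–Varadhan bound that is affine
    -- in the `p'`-probability of `G`.
    have key : ∀ x : ℝ, 0 < x → Real.log x ≤ Real.log z - 1 + x / z := by
      intro x hx
      have := Real.log_le_sub_one_of_pos (div_pos hx hz)
      rw [Real.log_div hx.ne' hz.ne'] at this
      linarith
    by_cases hl : l ∈ G
    · have := key (likelihoodRatio r l * K) (mul_pos hL hK)
      rw [Real.log_mul hL.ne' hK.ne'] at this
      simp only [χ, Set.indicator_of_mem hl, Pi.one_apply]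
      have e : 1 + (K - 1) * 1 = K := by ring
      rw [e]
      linarith
    · have := key _ hL
      simp only [χ, Set.indicator_of_notMem hl]
      simpa using this
  have i1 := integrable_comp_coinTranscript nx p (fun l => Real.log K * χ l) k
  have i2 := integrable_comp_coinTranscript nx p (fun l => Real.log (likelihoodRatio r l)) k
  have i3 := integrable_comp_coinTranscript nx p
    (fun l => Real.log z - 1 + (likelihoodRatio r l * (1 + (K - 1) * χ l)) / z) k
  have h := integral_mono (i1.add i2) i3 fun b => hpt (coinTranscript nx b k)
  have e1 : ∫ b, ((fun b => Real.log K * χ (coinTranscript nx b k)) +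
      fun b => Real.log (likelihoodRatio r (coinTranscript nx b k))) b ∂(coinTable p) =
      Real.log K * ∫ b, χ (coinTranscript nx b k) ∂(coinTable p) -
        ∫ b, ((coinTranscript nx b k).map fun q => κ q.1).sum ∂(coinTable p) := by
    rw [sub_eq_add_neg, ← integral_log_likelihoodRatio nx p r hr κ hκ, ← integral_const_mul]
    exact integral_add i1 i2
  have e2 : ∫ b, (Real.log z - 1 + (likelihoodRatio r (coinTranscript nx b k) *
      (1 + (K - 1) * χ (coinTranscript nx b k))) / z) ∂(coinTable p) =
      Real.log z - 1 + (1 + (K - 1) * ∫ b, χ (coinTranscript nx b k) ∂(coinTable p')) / z := by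
    rw [integral_add (integrable_const _) (integrable_comp_coinTranscript nx p
      (fun l => (likelihoodRatio r l * (1 + (K - 1) * χ l)) / z) k), integral_div,
      ← integral_change_measure nx p p' r ht hf (fun l => 1 + (K - 1) * χ l) k,
      integral_add (integrable_const _) ((integrable_comp_coinTranscript nx p' χ k).const_mul _),
      integral_const_mul]
    simp
  rw [hreal, hreal, ← e1, ← e2]
  exact h

end CoinAlgorithm

/-! ### Altering one fair coin, and summing over the coins altered. -/

section FairCoins

variable {A O : Type*} [DecidableEq A]

/-- The Kullback-Leibler divergence of a fair coin from a coin of bias `q`. -/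
noncomputable def fairDivergence (q : ℝ) : ℝ :=
  -(1 / 2 * Real.log (2 * q) + (1 - 1 / 2) * Real.log (2 * (1 - q)))

/-- The number of tosses of the coin `a` in a transcript. -/
def tossCount (a : A) (l : List (A × Bool)) : ℝ :=
  (l.countP fun q => decide (q.1 = a) : ℕ)

theorem tossCount_cons (a : A) (q : A × Bool) (l : List (A × Bool)) :
    tossCount a (q :: l) = tossCount a l + if q.1 = a then 1 else 0 := by
  rw [tossCount, List.countP_cons, Nat.cast_add, tossCount]
  by_cases h : q.1 = a <;> simp [h]

theorem sum_tossCount_le_length (J : Finset A) (l : List (A × Bool)) :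
    ∑ a ∈ J, tossCount a l ≤ l.length := by
  induction l with
  | nil => simp [tossCount]
  | cons q l ih =>
    have h : ∑ a ∈ J, (if q.1 = a then 1 else 0 : ℝ) ≤ 1 := by
      rw [Finset.sum_ite_eq]
      split <;> norm_num
    simp only [tossCount_cons, Finset.sum_add_distrib, List.length_cons, Nat.cast_add, Nat.cast_one]
    linarith

variable [Fintype A]

theorem transport_update_le (nx : List (A × Bool) → A ⊕ O) (p : A → unitInterval) (a : A)
    (hp : (p a : ℝ) = 1 / 2) (q : unitInterval) (hq0 : 0 < (q : ℝ)) (hq1 : (q : ℝ) < 1) (k : ℕ)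
    (G : Set (List (A × Bool))) {K z : ℝ} (hK : 0 < K) (hz : 0 < z) :
    Real.log K * (coinTable p).real {b | coinTranscript nx b k ∈ G} -
        fairDivergence q *
          ∫ b, tossCount a (coinTranscript nx b k) ∂(coinTable p) ≤
      Real.log z - 1 +
        (1 + (K - 1) *
          (coinTable (Function.update p a q)).real {b | coinTranscript nx b k ∈ G}) / z := by
  have hsum : ∀ l : List (A × Bool),
      (l.map fun x => if x.1 = a then fairDivergence q else 0).sum =
        fairDivergence q * tossCount a l := by
    intro l
    induction l with
    | nil => simp [tossCount]
    | cons x l ih =>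
      rw [List.map_cons, List.sum_cons, ih, tossCount_cons]
      by_cases h : x.1 = a
      · simp [h]; ring
      · simp [h]
  have h := transport_le nx p (Function.update p a q)
    (fun a' x => if a' = a then (if x then 2 * q else 2 * (1 - q)) else 1)
    (by
      intro a'
      by_cases h : a' = a
      · subst h; simp [hp]; ring
      · simp [h])
    (by
      intro a'
      by_cases h : a' = a
      · subst h; simp [hp]; ring
      · simp [h])
    (by
      intro a' x
      split
      · split <;> linarith
      · norm_num)
    (fun a' => if a' = a then fairDivergence q else 0)
    (by
      intro a'
      by_cases h : a' = a
      · subst h; simp [hp, fairDivergence]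
      · simp [h])
    k G hK hz
  simp only [hsum] at h
  rwa [integral_const_mul] at h

/-- All toss counts are taken under the same unaltered law `p`, so they add up to at most the length
of the transcript. -/
theorem sum_transport_update_le (nx : List (A × Bool) → A ⊕ O) (p : A → unitInterval)
    (J : Finset A) (hp : ∀ a ∈ J, (p a : ℝ) = 1 / 2) (q : unitInterval) (hq0 : 0 < (q : ℝ))
    (hq1 : (q : ℝ) < 1) (hκ : 0 ≤ fairDivergence q) (k : ℕ) (G : Set (List (A × Bool)))
    {K z : ℝ} (hK : 0 < K) (hz : 0 < z) :
    ∑ a ∈ J, (Real.log K * (coinTable p).real {b | coinTranscript nx b k ∈ G} -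
        (K - 1) / z * (coinTable (Function.update p a q)).real {b | coinTranscript nx b k ∈ G} -
        (Real.log z - 1 + 1 / z)) ≤
      fairDivergence q * ∫ b, ((coinTranscript nx b k).length : ℝ) ∂(coinTable p) := by
  have hint : ∀ a, Integrable (fun b =>
      tossCount a (coinTranscript nx b k)) (coinTable p) := fun a =>
    integrable_comp_coinTranscript nx p (tossCount a) k
  calc _ ≤ ∑ a ∈ J, fairDivergence q *
        ∫ b, tossCount a (coinTranscript nx b k) ∂(coinTable p) := by
        refine Finset.sum_le_sum fun a ha => ?_
        have := transport_update_le nx p a (hp a ha) q hq0 hq1 k G hK hz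
        rw [add_div, mul_div_right_comm] at this
        linarith
    _ = fairDivergence q * ∫ b, ∑ a ∈ J,
        tossCount a (coinTranscript nx b k) ∂(coinTable p) := by
        rw [integral_finsetSum _ fun a _ => hint a, Finset.mul_sum]
    _ ≤ _ := by
        refine mul_le_mul_of_nonneg_left ?_ hκ
        exact integral_mono (integrable_finsetSum _ fun a _ => hint a)
          (integrable_comp_coinTranscript nx p (fun l => (l.length : ℝ)) k)
          fun b => sum_tossCount_le_length J _

end FairCoins

/-! ### Private randomness and the limit of infinitely many steps. -/

section Randomized

variable {S A O : Type*} {nx : S → List (A × Bool) → A ⊕ O}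

/-- The event that the strategy has stopped after `k` tosses with an output in `D`. -/
def stopEvent (nx : S → List (A × Bool) → A ⊕ O) (D : Set O) (k : ℕ) :
    Set (S × (ℕ × A → Bool)) :=
  {ω | ∃ o ∈ D, nx ω.1 (coinTranscript (nx ω.1) ω.2 k) = Sum.inr o}

theorem stopEvent_mono (D : Set O) : Monotone (stopEvent nx D) := by
  refine monotone_nat_of_le_succ fun k ω ⟨o, ho, h⟩ => ⟨o, ho, ?_⟩
  simp only [coinTranscript, h]

theorem coinTranscript_length_le (nx : List (A × Bool) → A ⊕ O) (b : ℕ × A → Bool) (k : ℕ) :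
    (coinTranscript nx b k).length ≤ k := by
  induction k with
  | zero => simp [coinTranscript]
  | succ k ih =>
    simp only [coinTranscript]
    split
    · rw [List.length_append, List.length_singleton]
      omega
    · omega

variable [MeasurableSpace S] [Fintype A]


theorem measurableSet_coinTranscript_eq (hnx : ∀ l r, MeasurableSet {s | nx s l = r})
    (k : ℕ) (l : List (A × Bool)) :
    MeasurableSet {ω : S × (ℕ × A → Bool) | coinTranscript (nx ω.1) ω.2 k = l} := by
  induction k generalizing l with
  | zero => simp [coinTranscript]
  | succ k ih =>
    have h : {ω : S × (ℕ × A → Bool) | coinTranscript (nx ω.1) ω.2 (k + 1) = l} =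
        ⋃ l' : List (A × Bool), {ω : S × (ℕ × A → Bool) | coinTranscript (nx ω.1) ω.2 k = l'} ∩
          ((⋃ a : A, ({ω : S × (ℕ × A → Bool) | nx ω.1 l' = Sum.inl a} ∩
            {ω : S × (ℕ × A → Bool) | l' ++ [(a, ω.2 (k, a))] = l})) ∪
          ((⋃ a : A, {ω : S × (ℕ × A → Bool) | nx ω.1 l' = Sum.inl a})ᶜ ∩
            {_ω : S × (ℕ × A → Bool) | l' = l})) := by
      ext ω
      simp only [coinTranscript, Set.mem_ofPred_eq, Set.mem_iUnion, Set.mem_inter_iff,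
        Set.mem_union, Set.mem_compl_iff, exists_eq_left']
      rcases nx ω.1 (coinTranscript (nx ω.1) ω.2 k) with a | o <;> simp
    rw [h]
    refine MeasurableSet.iUnion fun l' => (ih l').inter (.union (.iUnion fun a => .inter ?_ ?_)
      (.inter (.compl (.iUnion fun a => ?_)) (.const _)))
    · exact measurable_fst (hnx l' (Sum.inl a))
    · have : {ω : S × (ℕ × A → Bool) | l' ++ [(a, ω.2 (k, a))] = l} =
          (fun ω : S × (ℕ × A → Bool) => ω.2 (k, a)) ⁻¹' {x | l' ++ [(a, x)] = l} := rfl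
      rw [this]
      exact (measurable_pi_apply (k, a)).comp measurable_snd (.of_discrete)
    · exact measurable_fst (hnx l' (Sum.inl a))

theorem measurable_coinTranscript_length (hnx : ∀ l r, MeasurableSet {s | nx s l = r}) (k : ℕ) :
    Measurable fun ω : S × (ℕ × A → Bool) => (coinTranscript (nx ω.1) ω.2 k).length := by
  refine measurable_to_countable' fun n => ?_
  have : (fun ω : S × (ℕ × A → Bool) => (coinTranscript (nx ω.1) ω.2 k).length) ⁻¹' {n} =
      ⋃ l : List (A × Bool), {ω : S × (ℕ × A → Bool) | coinTranscript (nx ω.1) ω.2 k = l} ∩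
        {_ω : S × (ℕ × A → Bool) | l.length = n} := by
    ext ω
    simp
  rw [this]
  exact .iUnion fun l => (measurableSet_coinTranscript_eq hnx k l).inter (.const _)

theorem measurableSet_stopEvent [Countable O] (hnx : ∀ l r, MeasurableSet {s | nx s l = r})
    (D : Set O) (k : ℕ) : MeasurableSet (stopEvent nx D k) := by
  have : stopEvent nx D k = ⋃ l : List (A × Bool), ⋃ o : O,
      {ω : S × (ℕ × A → Bool) | coinTranscript (nx ω.1) ω.2 k = l} ∩
        ({ω : S × (ℕ × A → Bool) | nx ω.1 l = Sum.inr o} ∩ {_ω | o ∈ D}) := by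
    ext ω
    simp [stopEvent, and_comm]
  rw [this]
  exact .iUnion fun l => .iUnion fun o => (measurableSet_coinTranscript_eq hnx k l).inter
    (.inter (measurable_fst (hnx l (Sum.inr o))) (.const _))

theorem integrable_coinTranscript_length (ρ : Measure S) [IsProbabilityMeasure ρ]
    (hnx : ∀ l r, MeasurableSet {s | nx s l = r}) (p : A → unitInterval) (k : ℕ) :
    Integrable (fun ω : S × (ℕ × A → Bool) => ((coinTranscript (nx ω.1) ω.2 k).length : ℝ))
      (ρ.prod (coinTable p)) := by
  refine Integrable.of_bound (C := k)
    ((measurable_of_countable _).comp (measurable_coinTranscript_length hnx k)).aestronglyMeasurable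
    (.of_forall fun ω => ?_)
  simpa using coinTranscript_length_le (nx ω.1) ω.2 k

variable [DecidableEq A] [Countable O]

theorem sum_transport_randomized_le (ρ : Measure S) [IsProbabilityMeasure ρ]
    (hnx : ∀ l r, MeasurableSet {s | nx s l = r}) (p : A → unitInterval)
    (J : Finset A) (hp : ∀ a ∈ J, (p a : ℝ) = 1 / 2) (q : unitInterval) (hq0 : 0 < (q : ℝ))
    (hq1 : (q : ℝ) < 1) (hκ : 0 ≤ fairDivergence q) (k : ℕ) (D : Set O)
    {K z : ℝ} (hK : 0 < K) (hz : 0 < z) :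
    ∑ a ∈ J, (Real.log K * (ρ.prod (coinTable p)).real (stopEvent nx D k) -
        (K - 1) / z * (ρ.prod (coinTable (Function.update p a q))).real (stopEvent nx D k) -
        (Real.log z - 1 + 1 / z)) ≤
      fairDivergence q * ∫ ω, ((coinTranscript (nx ω.1) ω.2 k).length : ℝ)
        ∂(ρ.prod (coinTable p)) := by
  have hD := measurableSet_stopEvent hnx D k
  have hreal : ∀ p' : A → unitInterval, (ρ.prod (coinTable p')).real (stopEvent nx D k) =
      ∫ s, (coinTable p').real (Prod.mk s ⁻¹' stopEvent nx D k) ∂ρ := by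
    intro p'
    rw [measureReal_def, Measure.prod_apply hD,
      ← integral_toReal (measurable_measure_prodMk_left hD).aemeasurable
        (.of_forall fun s => measure_lt_top _ _)]
    rfl
  have hint : ∀ p' : A → unitInterval,
      Integrable (fun s => (coinTable p').real (Prod.mk s ⁻¹' stopEvent nx D k)) ρ := by
    intro p'
    refine Integrable.of_bound (C := 1)
      (measurable_measure_prodMk_left hD).ennreal_toReal.aestronglyMeasurable
      (.of_forall fun s => ?_)
    rw [Real.norm_of_nonneg measureReal_nonneg]
    exact measureReal_le_one
  have hlen := integrable_coinTranscript_length ρ hnx p k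
  rw [integral_prod _ hlen, ← integral_const_mul]
  simp only [hreal]
  have hF : ∀ a, Integrable (fun s => Real.log K *
      (coinTable p).real (Prod.mk s ⁻¹' stopEvent nx D k) - (K - 1) / z *
      (coinTable (Function.update p a q)).real (Prod.mk s ⁻¹' stopEvent nx D k) -
      (Real.log z - 1 + 1 / z)) ρ :=
    fun a => (((hint p).const_mul _).sub ((hint _).const_mul _)).sub (integrable_const _)
  calc _ = ∫ s, ∑ a ∈ J, (Real.log K *
      (coinTable p).real (Prod.mk s ⁻¹' stopEvent nx D k) - (K - 1) / z *
      (coinTable (Function.update p a q)).real (Prod.mk s ⁻¹' stopEvent nx D k) -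
      (Real.log z - 1 + 1 / z)) ∂ρ := by
        rw [integral_finsetSum _ fun a _ => hF a]
        refine Finset.sum_congr rfl fun a _ => ?_
        have hsub : Integrable (fun s => Real.log K *
            (coinTable p).real (Prod.mk s ⁻¹' stopEvent nx D k) - (K - 1) / z *
            (coinTable (Function.update p a q)).real (Prod.mk s ⁻¹' stopEvent nx D k)) ρ :=
          ((hint p).const_mul _).sub ((hint _).const_mul _)
        rw [integral_sub hsub (integrable_const _),
          integral_sub ((hint p).const_mul _) ((hint _).const_mul _), integral_const_mul,
          integral_const_mul]
        simp
    _ ≤ _ := by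
        refine integral_mono (integrable_finsetSum _ fun a _ => hF a)
          (hlen.integral_prod_left.const_mul _) fun s => ?_
        exact sum_transport_update_le (nx s) p J hp q hq0 hq1 hκ k
          {l | ∃ o ∈ D, nx s l = Sum.inr o} hK hz

/-- Passing to the limit of infinitely many tosses. -/
theorem sum_transport_limit_le (ρ : Measure S) [IsProbabilityMeasure ρ]
    (hnx : ∀ l r, MeasurableSet {s | nx s l = r}) (p : A → unitInterval)
    (J : Finset A) (hp : ∀ a ∈ J, (p a : ℝ) = 1 / 2) (q : unitInterval) (hq0 : 0 < (q : ℝ))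
    (hq1 : (q : ℝ) < 1) (hκ : 0 ≤ fairDivergence q) (D : Set O)
    {K z : ℝ} (hK : 0 < K) (hz : 0 < z)
    (hfin : ∫⁻ ω, (⨆ k, ((coinTranscript (nx ω.1) ω.2 k).length : ℝ≥0∞))
      ∂(ρ.prod (coinTable p)) ≠ ∞) :
    ∑ a ∈ J, (Real.log K * (ρ.prod (coinTable p)).real (⋃ k, stopEvent nx D k) -
        (K - 1) / z * (ρ.prod (coinTable (Function.update p a q))).real (⋃ k, stopEvent nx D k) -
        (Real.log z - 1 + 1 / z)) ≤
      fairDivergence q * (∫⁻ ω, (⨆ k, ((coinTranscript (nx ω.1) ω.2 k).length : ℝ≥0∞))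
        ∂(ρ.prod (coinTable p))).toReal := by
  have hlim : ∀ p' : A → unitInterval, Filter.Tendsto
      (fun k => (ρ.prod (coinTable p')).real (stopEvent nx D k)) Filter.atTop
      (nhds ((ρ.prod (coinTable p')).real (⋃ k, stopEvent nx D k))) := fun p' =>
    (ENNReal.tendsto_toReal (measure_ne_top _ _)).comp
      (tendsto_measure_iUnion_atTop (stopEvent_mono D))
  -- Stopping is permanent, so the stop events increase with `k` and their probabilities converge;
  -- the expected length at each finite step is at most the expected supremum.
  refine le_of_tendsto (tendsto_finsetSum J fun a _ => (((hlim p).const_mul _).sub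
    ((hlim (Function.update p a q)).const_mul _)).sub_const _) (.of_forall fun k => ?_)
  refine (sum_transport_randomized_le ρ hnx p J hp q hq0 hq1 hκ k D hK hz).trans
    (mul_le_mul_of_nonneg_left ?_ hκ)
  rw [integral_eq_lintegral_of_nonneg_ae (.of_forall fun ω => by positivity)
    (integrable_coinTranscript_length ρ hnx p k).aestronglyMeasurable]
  refine ENNReal.toReal_mono hfin (lintegral_mono fun ω => ?_)
  rw [ENNReal.ofReal_natCast]
  exact le_iSup (fun k => ((coinTranscript (nx ω.1) ω.2 k).length : ℝ≥0∞)) k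

end Randomized

/-! ### From sampling algorithms to coin strategies. -/

section Reduction

variable {A : Type} {d : ℕ} {O : Type}

/-- The strategy on coins that simulates `alg` by turning an outcome of the coin of an arm into a
sample from this arm. -/
def coinStrategy (alg : SamplingAlgorithm.{u} A d O) (out : A → Bool → Fin d → ℝ) (s : alg.Seed)
    (l : List (A × Bool)) : A ⊕ O :=
  alg.next s (l.map fun q => (q.1, out q.1 q.2))

/-- The table of samples that a table of coins encodes. -/
def sampleTable (out : A → Bool → Fin d → ℝ) (b : ℕ × A → Bool) : ℕ × A → Fin d → ℝ :=
  fun q => out q.2 (b q)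

theorem transcript_sampleTable (alg : SamplingAlgorithm.{u} A d O) (out : A → Bool → Fin d → ℝ)
    (s : alg.Seed) (b : ℕ × A → Bool) (k : ℕ) :
    alg.transcript s (sampleTable out b) k =
      (coinTranscript (coinStrategy alg out s) b k).map fun q => (q.1, out q.1 q.2) := by
  induction k with
  | zero => rfl
  | succ k ih =>
    simp only [SamplingAlgorithm.transcript, coinTranscript]
    rw [ih]
    have h : alg.next s ((coinTranscript (coinStrategy alg out s) b k).map
        fun q => (q.1, out q.1 q.2)) =
        coinStrategy alg out s (coinTranscript (coinStrategy alg out s) b k) := rfl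
    rw [h]
    rcases coinStrategy alg out s (coinTranscript (coinStrategy alg out s) b k) with a | o
    · simp only [List.map_append, List.map_cons, List.map_nil, sampleTable]
    · rfl

theorem measurableSet_coinStrategy_eq (alg : SamplingAlgorithm.{u} A d O)
    (out : A → Bool → Fin d → ℝ) (l : List (A × Bool)) (r : A ⊕ O) :
    MeasurableSet {s | coinStrategy alg out s l = r} := by
  have h := alg.measurable_next l.length (fun j => (l.get j).1) r
  have hm : Measurable fun s : alg.Seed =>
      (s, fun j : Fin l.length => out (l.get j).1 (l.get j).2) := by fun_prop
  have h' := hm h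
  have e : (List.ofFn fun j : Fin l.length => ((l.get j).1, out (l.get j).1 (l.get j).2)) =
      l.map fun q => (q.1, out q.1 q.2) := by
    conv_rhs => rw [← List.ofFn_get l, List.map_ofFn]
    rfl
  simp only [Set.preimage_ofPred_eq, e] at h'
  exact h'

variable [Countable A] {out : A → Bool → Fin d → ℝ}

/-- An embedding allows measures and integrals to be pulled back to coins without proving that the
success event or the number of samples is measurable on the original space. -/
theorem measurableEmbedding_sampleTable (hout : ∀ a, Function.Injective (out a)) :
    MeasurableEmbedding (sampleTable out) := by
  refine Measurable.measurableEmbedding ?_ ?_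
  · refine measurable_pi_lambda _ fun q => ?_
    exact (measurable_of_countable (out q.2)).comp (measurable_pi_apply q)
  · intro b b' h
    funext q
    exact hout q.2 (congrFun h q)

theorem runLaw_eq_map (alg : SamplingAlgorithm.{u} A d O) (R : RewardModel A d)
    (p : A → unitInterval) (hlaw : ∀ a, R.law a = (coin (p a)).map (out a))
    (hout : ∀ a, Function.Injective (out a)) :
    alg.runLaw R = (alg.seedLaw.prod (coinTable p)).map (Prod.map id (sampleTable out)) := by
  have : ∀ a, IsProbabilityMeasure (R.law a) := R.isProb
  rw [← Measure.map_prod_map _ _ measurable_id (measurableEmbedding_sampleTable hout).measurable,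
    Measure.map_id]
  unfold SamplingAlgorithm.runLaw
  congr 1
  unfold coinTable
  have h := Measure.infinitePi_map_pi (fun q : ℕ × A => coin (p q.2))
    (f := fun q : ℕ × A => out q.2) (fun q => measurable_of_countable _)
  rw [show sampleTable out = fun b q => out q.2 (b q) from rfl, h]
  simp only [hlaw]

theorem measurableEmbedding_prodMap_sampleTable {S : Type*} [MeasurableSpace S]
    (hout : ∀ a, Function.Injective (out a)) :
    MeasurableEmbedding (Prod.map (id : S → S) (sampleTable out)) :=
  MeasurableEmbedding.id.prodMap (measurableEmbedding_sampleTable hout)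

theorem expectedSamples_eq_lintegral (alg : SamplingAlgorithm.{u} A d O) (R : RewardModel A d)
    (p : A → unitInterval) (hlaw : ∀ a, R.law a = (coin (p a)).map (out a))
    (hout : ∀ a, Function.Injective (out a)) :
    alg.expectedSamples R =
      ∫⁻ ω, (⨆ k, ((coinTranscript (coinStrategy alg out ω.1) ω.2 k).length : ℝ≥0∞))
        ∂(alg.seedLaw.prod (coinTable p)) := by
  rw [SamplingAlgorithm.expectedSamples, runLaw_eq_map alg R p hlaw hout,
    (measurableEmbedding_prodMap_sampleTable hout).lintegral_map]
  simp only [SamplingAlgorithm.numSamples, Prod.map_fst, Prod.map_snd, id_eq,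
    transcript_sampleTable, List.length_map]

theorem le_measure_stopEvent (alg : SamplingAlgorithm.{u} A d O) (R : RewardModel A d)
    (p : A → unitInterval) (hlaw : ∀ a, R.law a = (coin (p a)).map (out a))
    (hout : ∀ a, Function.Injective (out a)) (D : Set O) (x : ℝ)
    (h : ENNReal.ofReal x ≤ alg.runLaw R {ω | ∃ o, alg.Outputs ω.1 ω.2 o ∧ o ∈ D}) :
    x ≤ (alg.seedLaw.prod (coinTable p)).real (⋃ k, stopEvent (coinStrategy alg out) D k) := by
  rw [runLaw_eq_map alg R p hlaw hout,
    (measurableEmbedding_prodMap_sampleTable hout).map_apply] at h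
  rw [measureReal_def, ← ENNReal.ofReal_le_iff_le_toReal (measure_ne_top _ _)]
  refine h.trans (measure_mono fun ω hω => ?_)
  obtain ⟨o, ⟨k, hk⟩, ho⟩ := hω
  refine Set.mem_iUnion.2 ⟨k, o, ho, ?_⟩
  simp only [Prod.map_fst, Prod.map_snd, id_eq, transcript_sampleTable] at hk
  exact hk

end Reduction

/-! ### Digits and the order of the groups. -/

section Digits

theorem le_of_digits_le {B : ℕ} (d : ℕ) {t t' : ℕ} (ht : t < B ^ d)
    (h : ∀ i < d, t / B ^ i % B ≤ t' / B ^ i % B) : t ≤ t' := by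
  induction d generalizing t t' with
  | zero => simp at ht; omega
  | succ d ih =>
    have h1 : t / B ≤ t' / B := by
      refine ih (Nat.div_lt_of_lt_mul (by rwa [pow_succ'] at ht)) fun i hi => ?_
      have := h (i + 1) (by omega)
      rwa [pow_succ', ← Nat.div_div_eq_div_mul, ← Nat.div_div_eq_div_mul] at this
    have h0 := h 0 (by omega)
    simp only [pow_zero, Nat.div_one] at h0
    rw [← Nat.div_add_mod t B, ← Nat.div_add_mod t' B]
    exact Nat.add_le_add (Nat.mul_le_mul_left B h1) h0

theorem exists_digit_lt {B d t t' : ℕ} (ht : t < B ^ d) (h : t' < t) :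
    ∃ i : Fin d, digit B d t' i < digit B d t i := by
  by_contra! hc
  refine absurd (le_of_digits_le d ht fun i hi => ?_) (not_le.2 h)
  -- `digit` counts from the most significant end, `le_of_digits_le` from the least.
  have := hc ⟨d - 1 - i, by omega⟩
  simp only [digit] at this
  rwa [show d - 1 - (d - 1 - i) = i by omega] at this

theorem digit_lt {B d t : ℕ} (hB : 0 < B) (i : Fin d) : digit B d t i < B := Nat.mod_lt _ hB

end Digits

/-! ### The hard instances and what a correct output reveals. -/

section HardInstances

variable {T m : ℕ}

/-- The sample of an arm that corresponds to an outcome of its coin. -/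
noncomputable def hardOutcome (B d : ℕ) (ε : ℝ) (a : Fin T × Fin m) (x : Bool) : Fin d → ℝ :=
  fun i => 1 / 4 + 4 * ε * (digit B d a.1 i : ℝ) + if x then 1 / 4 else -(1 / 4)

theorem hardOutcome_injective {B d : ℕ} (hd : 1 ≤ d) (ε : ℝ) (a : Fin T × Fin m) :
    Function.Injective (hardOutcome B d ε a) := by
  intro x y h
  have := congrFun h ⟨0, hd⟩
  cases x <;> cases y <;> simp [hardOutcome] at this ⊢ <;> linarith

theorem hardOutcome_mem {B d : ℕ} {ε : ℝ} (hB : 0 < B) (hε : 0 < ε) (hεB : 8 * ε * B = 1)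
    (a : Fin T × Fin m) (x : Bool) (i : Fin d) :
    hardOutcome B d ε a x i ∈ Set.Icc (0 : ℝ) 1 := by
  have h : (digit B d a.1 i : ℝ) ≤ B := by exact_mod_cast (digit_lt hB i).le
  have h1 : 4 * ε * (digit B d a.1 i : ℝ) ≤ 1 / 2 := by nlinarith
  have h2 : 0 ≤ 4 * ε * (digit B d a.1 i : ℝ) := by positivity
  unfold hardOutcome
  split <;> constructor <;> linarith

variable [NeZero m]

/-- The excess of the `s`-value of an arm over `1/4` in the hard instance `θ`: the arm `0` of a
group is good, and the arm `θ t` of the group `t` is better if it is not the arm `0`. -/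
noncomputable def hardShift (ε : ℝ) (θ : Fin T → Fin m) (a : Fin T × Fin m) : ℝ :=
  if a.2 = 0 then 3 / 2 * ε else if a.2 = θ a.1 then 3 * ε else 0

theorem hardShift_mem {ε : ℝ} (hε : 0 < ε) (θ : Fin T → Fin m) (a : Fin T × Fin m) :
    0 ≤ hardShift ε θ a ∧ hardShift ε θ a ≤ 3 * ε := by
  unfold hardShift
  split_ifs <;> constructor <;> linarith

theorem hardShift_best {ε : ℝ} (hε : 0 < ε) (θ : Fin T → Fin m) (t : Fin T) :
    3 / 2 * ε ≤ hardShift ε θ (t, θ t) := by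
  unfold hardShift
  split_ifs with h1 h2
  · exact le_rfl
  · linarith
  · simp at h2

/-- The value of the arm `0` lies midway between `0` and `3ε`: it wins by `3ε/2` when it is best and
loses by `3ε/2` otherwise. Hence raising one other arm is enough to change the best arm. -/
theorem hardShift_gap {ε : ℝ} (hε : 0 < ε) (θ : Fin T → Fin m) (t : Fin T) {j : Fin m}
    (hj : j ≠ θ t) : hardShift ε θ (t, j) + ε < hardShift ε θ (t, θ t) := by
  unfold hardShift
  simp only [hj, if_false, if_true]
  split_ifs with h1 h2
  · exact absurd (h1.trans h2.symm) hj
  · linarith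
  · linarith
  · linarith

/-- The bias of the coin that drives an arm in the hard instance `θ`. -/
noncomputable def hardBias (ε : ℝ) (θ : Fin T → Fin m) (a : Fin T × Fin m) : unitInterval :=
  Set.projIcc 0 1 zero_le_one (1 / 2 + 2 * hardShift ε θ a)

theorem coe_hardBias {ε : ℝ} (hε : 0 < ε) (hε' : ε ≤ 1 / 16) (θ : Fin T → Fin m)
    (a : Fin T × Fin m) : (hardBias ε θ a : ℝ) = 1 / 2 + 2 * hardShift ε θ a := by
  have h := hardShift_mem hε θ a
  rw [hardBias, Set.projIcc_of_mem zero_le_one (x := 1 / 2 + 2 * hardShift ε θ a)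
    ⟨by linarith, by linarith⟩]

/-- The bias of the coin of the best arm of a group if this is not the arm `0`. -/
noncomputable def topBias (ε : ℝ) : unitInterval :=
  Set.projIcc 0 1 zero_le_one (1 / 2 + 2 * (3 * ε))

theorem coe_topBias {ε : ℝ} (hε : 0 < ε) (hε' : ε ≤ 1 / 16) :
    (topBias ε : ℝ) = 1 / 2 + 2 * (3 * ε) := by
  rw [topBias, Set.projIcc_of_mem zero_le_one (x := 1 / 2 + 2 * (3 * ε))
    ⟨by linarith, by linarith⟩]

theorem hardBias_update (ε : ℝ) {θ : Fin T → Fin m} {t : Fin T} (ht : θ t = 0) {j : Fin m}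
    (hj : j ≠ 0) :
    hardBias ε (Function.update θ t j) = Function.update (hardBias ε θ) (t, j) (topBias ε) := by
  funext ⟨t', j'⟩
  by_cases h : (t', j') = (t, j)
  · obtain ⟨rfl, rfl⟩ := Prod.mk.inj h
    simp [hardBias, topBias, hardShift, hj]
  · rw [Function.update_of_ne h]
    unfold hardBias
    congr 3
    unfold hardShift
    by_cases h1 : t' = t
    · subst h1
      have : j' ≠ j := fun h2 => h (by rw [h2])
      by_cases h3 : j' = 0 <;> simp [this, ht, h3]
    · simp [h1]

/-- The reward model of the hard instance `θ`. -/
noncomputable def hardModel {B d : ℕ} {ε : ℝ} (hB : 0 < B) (hε : 0 < ε) (hεB : 8 * ε * B = 1)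
    (θ : Fin T → Fin m) : RewardModel (Fin T × Fin m) d where
  law a := (coin (hardBias ε θ a)).map (hardOutcome B d ε a)
  isProb a := Measure.isProbabilityMeasure_map (measurable_of_countable _).aemeasurable
  supported a := by
    rw [ae_map_iff (measurable_of_countable _).aemeasurable]
    · exact .of_forall fun x i => hardOutcome_mem hB hε hεB a x i
    · have : {x : Fin d → ℝ | ∀ i, x i ∈ Set.Icc (0 : ℝ) 1} =
          Set.univ.pi fun _ => Set.Icc (0 : ℝ) 1 := by
        ext; simp only [Set.mem_ofPred_eq, Set.mem_univ_pi]
      rw [this]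
      exact .univ_pi fun _ => measurableSet_Icc

variable {B d : ℕ} {ε : ℝ}

theorem weight_hardModel (hB : 2 ≤ B) (hε : 0 < ε) (hεB : 8 * ε * B = 1) (θ : Fin T → Fin m)
    (a : Fin T × Fin m) (i : Fin d) :
    (hardModel (d := d) (by omega) hε hεB θ).weight a i =
      1 / 4 + hardShift ε θ a + 4 * ε * (digit B d a.1 i : ℝ) := by
  have hB' : (2 : ℝ) ≤ B := by exact_mod_cast hB
  have hε' : ε ≤ 1 / 16 := by nlinarith
  simp only [RewardModel.weight, hardModel]
  rw [integral_map (measurable_of_countable _).aemeasurable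
    (f := fun x : Fin d → ℝ => x i) (measurable_pi_apply i).aestronglyMeasurable, integral_coin, coe_hardBias hε hε']
  simp only [hardOutcome, if_true, Bool.false_eq_true, if_false]
  ring

/-- In some coordinate the later group has a larger digit, worth at least `4ε`. The excess of the
earlier arm over the best later arm recovers at most `3ε - 3ε/2`, which leaves a deficit of at least
`5ε/2`. -/
theorem not_epsDominates_hardModel (hB : 2 ≤ B) (hε : 0 < ε) (hεB : 8 * ε * B = 1)
    (θ : Fin (B ^ d) → Fin m) {t' t : Fin (B ^ d)} (h : t' < t) (j : Fin m) :
    ¬ EpsDominates (hardModel (d := d) (by omega) hε hεB θ).weight ε (t', j) (t, θ t) := by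
  intro hdom
  obtain ⟨i, hi⟩ := exists_digit_lt t.2 h
  have h1 := hdom i
  rw [weight_hardModel hB, weight_hardModel hB] at h1
  have h2 : (digit B d t' i : ℝ) + 1 ≤ digit B d t i := by exact_mod_cast hi
  have h3 := hardShift_best hε θ t
  have h4 := (hardShift_mem hε θ (t', j)).2
  dsimp only at h1
  nlinarith

/-- A correct output for the hard instance `θ` reveals `θ`. -/
theorem mem_iff_of_isEpsPareto (hB : 2 ≤ B) (hε : 0 < ε) (hεB : 8 * ε * B = 1)
    (θ : Fin (B ^ d) → Fin m) {t : Fin (B ^ d)} {S : Finset (Fin (B ^ d) × Fin m)}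
    (h : IsEpsPareto (singleCopy (B ^ d) m) (hardModel (d := d) (by omega) hε hεB θ).weight ε t S)
    (j : Fin m) : (t, j) ∈ S ↔ j = θ t := by
  obtain ⟨h1, h2, h3⟩ := h
  have hbest : (t, θ t) ∈ (singleCopy (B ^ d) m).arms t := by
    simp only [RangeInput.arms, singleCopy, Set.mem_ofPred_eq]
    exact ⟨by positivity, le_rfl⟩
  constructor
  · intro hS
    by_contra hj
    refine h3 _ hS ⟨_, hbest, fun i => ?_⟩
    rw [weight_hardModel hB, weight_hardModel hB]
    have := hardShift_gap hε θ t hj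
    linarith
  · rintro rfl
    -- The arm covering the best arm of group `t` cannot come from a later group, by the interval,
    -- nor from an earlier one, by the digits. Another arm of group `t` would be beaten by more than
    -- `ε`, so the best arm itself is in `S`.
    obtain ⟨⟨t', j⟩, hS, hdom⟩ := h2 _ hbest
    have ht' : t' ≤ t := by
      have := (h1 _ hS).2
      simp only [singleCopy, add_le_add_iff_right, Nat.cast_le] at this
      exact this
    rcases ht'.lt_or_eq with hlt | rfl
    · exact absurd hdom (not_epsDominates_hardModel hB hε hεB θ hlt j)
    · by_cases hj : j = θ t'
      · rwa [← hj]
      · refine absurd ⟨_, hbest, fun i => ?_⟩ (h3 _ hS)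
        rw [weight_hardModel hB, weight_hardModel hB]
        have := hardShift_gap hε θ t' hj
        linarith

end HardInstances

/-! ### Averaging over a product prior. -/

section Averaging

variable {T m : ℕ} [NeZero m]

/-- The prior probability of the state of one group. -/
noncomputable def groupPrior (m : ℕ) [NeZero m] (j : Fin m) : ℝ :=
  if j = 0 then 1 / 4 else 3 / (4 * (m - 1))

/-- The product prior on the hard instances. -/
noncomputable def prior (θ : Fin T → Fin m) : ℝ := ∏ t, groupPrior m (θ t)

theorem prior_nonneg (hm : 2 ≤ m) (θ : Fin T → Fin m) : 0 ≤ prior θ := by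
  have hm' : (2 : ℝ) ≤ m := by exact_mod_cast hm
  refine Finset.prod_nonneg fun t _ => ?_
  unfold groupPrior
  split
  · norm_num
  · exact div_nonneg (by norm_num) (by linarith)

theorem card_filter_ne_zero : ((Finset.univ.filter fun j : Fin m => j ≠ 0).card : ℝ) = m - 1 := by
  have h : (Finset.univ.filter fun j : Fin m => j ≠ 0) = Finset.univ.erase 0 := by
    ext; simp
  rw [h, Finset.card_erase_of_mem (Finset.mem_univ _), Finset.card_univ, Fintype.card_fin,
    Nat.cast_sub (NeZero.one_le), Nat.cast_one]

theorem sum_prior (hm : 2 ≤ m) : ∑ θ : Fin T → Fin m, prior θ = 1 := by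
  have hm' : (2 : ℝ) ≤ m := by exact_mod_cast hm
  have h1 : ∑ j, groupPrior m j = 1 := by
    unfold groupPrior
    rw [Finset.sum_ite, Finset.sum_const, Finset.sum_const, nsmul_eq_mul, nsmul_eq_mul,
      Finset.filter_eq' Finset.univ (0 : Fin m), if_pos (Finset.mem_univ _), Finset.card_singleton,
      card_filter_ne_zero]
    have : (m : ℝ) - 1 ≠ 0 := by linarith
    field_simp
    norm_num
  have h := Finset.prod_univ_sum (fun _ : Fin T => (Finset.univ : Finset (Fin m)))
    (fun _ j => groupPrior m j)
  rw [Fintype.piFinset_univ] at h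
  simp only [h1, Finset.prod_const_one] at h
  exact h.symm

theorem prior_eq_mul_prior_update (hm : 2 ≤ m) {θ : Fin T → Fin m} {t : Fin T} (ht : θ t = 0)
    {j : Fin m} (hj : j ≠ 0) : prior θ = (m - 1) / 3 * prior (Function.update θ t j) := by
  have hm' : (2 : ℝ) ≤ m := by exact_mod_cast hm
  have h0 : (m : ℝ) - 1 ≠ 0 := by linarith
  unfold prior
  rw [← Finset.mul_prod_erase _ _ (Finset.mem_univ t),
    ← Finset.mul_prod_erase _ (fun s => groupPrior m (Function.update θ t j s))
      (Finset.mem_univ t)]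
  have : ∏ s ∈ Finset.univ.erase t, groupPrior m (Function.update θ t j s) =
      ∏ s ∈ Finset.univ.erase t, groupPrior m (θ s) :=
    Finset.prod_congr rfl fun s hs => by rw [Function.update_of_ne (Finset.ne_of_mem_erase hs)]
  rw [this, ht, Function.update_self]
  simp only [groupPrior, hj, if_true, if_false]
  field_simp

/-- Reindexing the pairs of an instance and a modification of its group `t` by the modified
instance. -/
theorem sum_prior_update (hm : 2 ≤ m) (t : Fin T) (F : (Fin T → Fin m) → (Fin T → Fin m) → ℝ) :
    ∑ θ : Fin T → Fin m, ∑ j : Fin m,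
        (if θ t = 0 ∧ j ≠ 0 then prior θ * F θ (Function.update θ t j) else 0) =
      (m - 1) / 3 * ∑ θ : Fin T → Fin m,
        if θ t ≠ 0 then prior θ * F (Function.update θ t 0) θ else 0 := by
  rw [← Fintype.sum_prod_type', ← Finset.sum_filter, ← Finset.sum_filter, Finset.mul_sum]
  refine Finset.sum_bij' (fun x _ => Function.update x.1 t x.2)
    (fun θ _ => (Function.update θ t 0, θ t)) ?_ ?_ ?_ ?_ ?_
  · rintro ⟨θ, j⟩ h
    simpa using (Finset.mem_filter.1 h).2.2
  · intro θ h
    simpa using (Finset.mem_filter.1 h).2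
  · rintro ⟨θ, j⟩ h
    have h1 : θ t = 0 := (Finset.mem_filter.1 h).2.1
    simp [← h1]
  · intro θ h
    simp
  · rintro ⟨θ, j⟩ h
    obtain ⟨h1, h2⟩ := (Finset.mem_filter.1 h).2
    dsimp only at h1 h2 ⊢
    rw [prior_eq_mul_prior_update hm h1 h2, Function.update_idem, ← h1, Function.update_eq_self]
    ring

theorem sum_prior_eq_zero (hm : 2 ≤ m) (t : Fin T) :
    ∑ θ : Fin T → Fin m, ∑ j : Fin m, (if θ t = 0 ∧ j ≠ 0 then prior θ else 0) =
      ((m : ℝ) - 1) / 4 := by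
  have h := sum_prior_update hm t fun _ _ => 1
  simp only [mul_one] at h
  have h1 : ∑ θ : Fin T → Fin m, ∑ j : Fin m, (if θ t = 0 ∧ j ≠ 0 then prior θ else 0) =
      (m - 1) * ∑ θ : Fin T → Fin m, if θ t = 0 then prior θ else 0 := by
    rw [Finset.mul_sum]
    refine Finset.sum_congr rfl fun θ _ => ?_
    by_cases hθ : θ t = 0
    · simp only [hθ, true_and, if_true]
      rw [← Finset.sum_filter, Finset.sum_const, nsmul_eq_mul, card_filter_ne_zero]
    · simp [hθ]
  have h2 : (∑ θ : Fin T → Fin m, if θ t = 0 then prior θ else 0) +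
      ∑ θ : Fin T → Fin m, (if θ t ≠ 0 then prior θ else 0) = 1 := by
    rw [← Finset.sum_add_distrib, ← sum_prior (T := T) hm]
    refine Finset.sum_congr rfl fun θ _ => ?_
    by_cases hθ : θ t = 0 <;> simp [hθ]
  -- The prior masses of `θ t = 0` and `θ t ≠ 0` sum to one, and the double sum is `m - 1` times the
  -- former and `(m - 1) / 3` times the latter.
  linear_combination 1 / 4 * h1 + 3 / 4 * h + ((m : ℝ) - 1) / 4 * h2

/-- Resetting different nonzero groups gives distinct instances, all different from `θ`, so together
they share the mass at most `δ` that `P` leaves outside `θ`. This is the source of the gain of a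
factor `T` inside the logarithm. -/
theorem sum_update_zero_le {δ : ℝ} (P : (Fin T → Fin m) → ℝ) (hP : ∀ θ, 0 ≤ P θ)
    (hsum : ∑ θ, P θ ≤ 1) (θ : Fin T → Fin m) (hθ : 1 - δ ≤ P θ) :
    ∑ t, (if θ t ≠ 0 then P (Function.update θ t 0) else 0) ≤ δ := by
  have hinj : Set.InjOn (fun t => Function.update θ t 0)
      (Finset.univ.filter fun t => θ t ≠ 0 : Finset (Fin T)) := by
    intro t ht t' _ h
    by_contra hne
    have h1 := congrFun h t
    simp only [Function.update_self, Function.update_of_ne hne] at h1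
    simp only [Finset.coe_filter, Finset.mem_univ, true_and] at ht
    exact ht h1.symm
  rw [← Finset.sum_filter, ← Finset.sum_image hinj]
  have hsub : (Finset.univ.filter fun t => θ t ≠ 0).image (fun t => Function.update θ t 0) ⊆
      Finset.univ.erase θ := by
    intro θ' h
    obtain ⟨t, ht, rfl⟩ := Finset.mem_image.1 h
    refine Finset.mem_erase.2 ⟨fun e => (Finset.mem_filter.1 ht).2 ?_, Finset.mem_univ _⟩
    simpa using (congrFun e t).symm
  have h1 := Finset.sum_le_sum_of_subset_of_nonneg hsub fun θ' _ _ => hP θ'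
  have h2 := Finset.add_sum_erase Finset.univ P (Finset.mem_univ θ)
  linarith

/-- The average over the prior of the transport inequalities. Here `P θ' θ` is the probability of
finding `θ` in the instance `θ'`. -/
theorem averaged_transport_le (hm : 2 ≤ m) {δ α β γ M : ℝ} (hα : 0 ≤ α) (hγ : 0 ≤ γ)
    (P : (Fin T → Fin m) → (Fin T → Fin m) → ℝ) (hP : ∀ θ' θ, 0 ≤ P θ' θ)
    (hsum : ∀ θ', ∑ θ, P θ' θ ≤ 1) (hcorrect : ∀ θ, 1 - δ ≤ P θ θ)
    (h : ∀ θ : Fin T → Fin m, ∑ a ∈ Finset.univ.filter (fun a : Fin T × Fin m =>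
        θ a.1 = 0 ∧ a.2 ≠ 0), (α * P θ θ - γ * P (Function.update θ a.1 a.2) θ - β) ≤ M) :
    T * ((m : ℝ) - 1) / 4 * (α * (1 - δ) - β) - γ * ((m - 1) / 3 * δ) ≤ M := by
  have hm' : (2 : ℝ) ≤ m := by exact_mod_cast hm
  have h1 : ∀ θ : Fin T → Fin m, (α * (1 - δ) - β) *
      ∑ t, ∑ j : Fin m, (if θ t = 0 ∧ j ≠ 0 then prior θ else 0) - γ *
      ∑ t, ∑ j : Fin m,
        (if θ t = 0 ∧ j ≠ 0 then prior θ * P (Function.update θ t j) θ else 0) ≤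
      prior θ * M := by
    intro θ
    refine le_trans ?_ (mul_le_mul_of_nonneg_left (h θ) (prior_nonneg hm θ))
    rw [Finset.sum_filter, Fintype.sum_prod_type]
    simp only [Finset.mul_sum, ← Finset.sum_sub_distrib]
    refine Finset.sum_le_sum fun t _ => Finset.sum_le_sum fun j _ => ?_
    split
    · have := mul_le_mul_of_nonneg_left (mul_le_mul_of_nonneg_left (hcorrect θ) hα)
        (prior_nonneg hm θ)
      nlinarith
    · simp
  have h2 := Finset.sum_le_sum fun θ (_ : θ ∈ Finset.univ) => h1 θ
  rw [← Finset.sum_mul, sum_prior hm, one_mul, Finset.sum_sub_distrib, ← Finset.mul_sum,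
    ← Finset.mul_sum, Finset.sum_comm, Finset.sum_comm (s := Finset.univ (α := Fin T → Fin m))] at h2
  simp only [sum_prior_eq_zero hm] at h2
  have h3 := fun t => sum_prior_update hm t (fun θ θ' => P θ' θ)
  simp only [h3, ← Finset.mul_sum] at h2
  have h4 : ∑ t : Fin T, ∑ θ : Fin T → Fin m,
      (if θ t ≠ 0 then prior θ * P θ (Function.update θ t 0) else 0) ≤ δ := by
    rw [Finset.sum_comm]
    calc _ ≤ ∑ θ : Fin T → Fin m, prior θ * δ := by
          refine Finset.sum_le_sum fun θ _ => ?_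
          have := mul_le_mul_of_nonneg_left
            (sum_update_zero_le (P θ) (hP θ) (hsum θ) θ (hcorrect θ)) (prior_nonneg hm θ)
          simpa only [Finset.mul_sum, mul_ite, mul_zero] using this
      _ = δ := by rw [← Finset.sum_mul, sum_prior hm, one_mul]
  have h5 := mul_le_mul_of_nonneg_left (mul_le_mul_of_nonneg_left h4
    (by linarith : 0 ≤ ((m : ℝ) - 1) / 3)) hγ
  simp only [Finset.sum_const, Finset.card_univ, Fintype.card_fin, nsmul_eq_mul] at h2
  linarith

end Averaging

/-! ### Numerical estimates. -/

section Numerics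

theorem log_inv_le_of_le_third {y : ℝ} (hy : 0 < y) (hy' : y ≤ 1 / 3) :
    1 / 30 * Real.log y⁻¹ ≤ -Real.log (4 * y * (1 - y)) := by
  have hpos : 0 < 4 * y * (1 - y) := by nlinarith
  -- For small `y`, `(4y(1-y))² ≤ 16y² ≤ y`. Otherwise `4y(1-y)` is at most its value `8/9` at
  -- `1/3`, while `log y⁻¹ ≤ 4 log 2`.
  by_cases h : y ≤ 1 / 16
  · have h1 : Real.log (4 * y * (1 - y)) ≤ 1 / 2 * Real.log y := by
      have : (4 * y * (1 - y)) ^ 2 ≤ y := by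
        have : 4 * y * (1 - y) ≤ 4 * y := by nlinarith
        nlinarith
      have := Real.log_le_log (by positivity) this
      rw [Real.log_pow] at this
      push_cast at this
      linarith
    have h2 : Real.log y ≤ 0 := Real.log_nonpos hy.le (by linarith)
    rw [Real.log_inv]
    linarith
  · push Not at h
    have h1 : 4 * y * (1 - y) ≤ 8 / 9 := by nlinarith
    have h2 : Real.log (4 * y * (1 - y)) ≤ -(1 / 9) := by
      have := Real.log_le_sub_one_of_pos hpos
      linarith
    have h3 : Real.log y⁻¹ ≤ Real.log ((2 : ℝ) ^ 4) :=
      Real.log_le_log (by positivity) (by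
        rw [inv_le_comm₀ hy (by norm_num)]
        norm_num
        linarith)
    rw [Real.log_pow] at h3
    have := Real.log_two_lt_d9
    push_cast at h3
    linarith

theorem log_div_le {x δ : ℝ} (hx : 2 ≤ x) (hδ : 0 < δ) (hδ' : δ ≤ 1 / 2) :
    1 / 2 * Real.log (x / δ) ≤ Real.log (4 * δ / (3 * x))⁻¹ := by
  have hu : 4 ≤ x / δ := by
    rw [le_div_iff₀ hδ]
    linarith
  have e : (4 * δ / (3 * x))⁻¹ = 3 / 4 * (x / δ) := by
    field_simp
  have h : x / δ ≤ (3 / 4 * (x / δ)) ^ 2 := by nlinarith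
  have := Real.log_le_log (by linarith) h
  rw [Real.log_pow] at this
  push_cast at this
  rw [e]
  linarith

theorem log_accuracy_le {B d : ℕ} {ε δ : ℝ} (hB : 2 ≤ B) (hε : 0 < ε)
    (hεB : 8 * ε * B = 1) (hδ : 0 < δ) (hδ' : δ ≤ 1 / 2) :
    Real.log (1 / (ε ^ d * δ)) ≤ 4 * Real.log ((B ^ d : ℕ) / δ) := by
  have hB' : (2 : ℝ) ≤ B := by exact_mod_cast hB
  have h1 : ε⁻¹ ≤ (B : ℝ) ^ 4 := by
    have e : ε⁻¹ = 8 * B := by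
      field_simp
      linarith
    have : (2 : ℝ) ^ 3 ≤ (B : ℝ) ^ 3 := pow_le_pow_left₀ (by norm_num) hB' 3
    rw [e]
    nlinarith
  have h2 : 1 / (ε ^ d * δ) ≤ ((B ^ d : ℕ) / δ) ^ 4 := by
    have h3 : δ⁻¹ ≤ δ⁻¹ ^ 4 := le_self_pow₀ (by
      rw [one_le_inv₀ hδ]; linarith) (by norm_num)
    calc 1 / (ε ^ d * δ) = ε⁻¹ ^ d * δ⁻¹ := by
          rw [one_div, mul_inv, inv_pow]
      _ ≤ ((B : ℝ) ^ 4) ^ d * δ⁻¹ ^ 4 := by gcongr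
      _ = _ := by
          push_cast
          rw [div_eq_mul_inv, mul_pow, ← pow_mul, ← pow_mul, mul_comm 4 d]
  have := Real.log_le_log (by positivity) h2
  rwa [Real.log_pow] at this

theorem fairDivergence_bounds {ε : ℝ} (hε : 0 < ε) (hε' : ε ≤ 1 / 16) :
    0 ≤ fairDivergence (1 / 2 + 2 * (3 * ε)) ∧
      fairDivergence (1 / 2 + 2 * (3 * ε)) ≤ 165 * ε ^ 2 := by
  have h1 : 0 < 1 - 12 * ε := by linarith
  have h2 : 0 < 1 + 12 * ε := by linarith
  have e : fairDivergence (1 / 2 + 2 * (3 * ε)) = -(1 / 2) * Real.log (1 - 144 * ε ^ 2) := by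
    rw [show 1 - 144 * ε ^ 2 = (1 + 12 * ε) * (1 - 12 * ε) by ring, Real.log_mul h2.ne' h1.ne',
      fairDivergence]
    ring_nf
  have hsq : ε ^ 2 ≤ 1 / 256 := by nlinarith
  have h3 : 0 < 1 - 144 * ε ^ 2 := by linarith
  rw [e]
  constructor
  · have : Real.log (1 - 144 * ε ^ 2) ≤ 0 := Real.log_nonpos h3.le (by nlinarith)
    linarith
  · have h4 := Real.one_sub_inv_le_log_of_pos h3
    -- Since `ε² ≤ 1/256`, the factor `1 - 144ε²` is at least `7/16`, and `144 · 16/7 < 330`.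
    have h5 : (1 - 144 * ε ^ 2)⁻¹ ≤ 1 + 330 * ε ^ 2 := by
      rw [inv_le_iff_one_le_mul₀ h3]
      nlinarith [sq_nonneg ε]
    linarith

end Numerics

/-! ### Assembling the lower bound. -/

/-- The outputs that reveal the hard instance `θ`. -/
def revealing {T m : ℕ} (θ : Fin T → Fin m) : Set (Fin T → Finset (Fin T × Fin m)) :=
  {o | ∀ t j, (t, j) ∈ o t ↔ j = θ t}

theorem eq_of_mem_revealing {T m : ℕ} {θ θ' : Fin T → Fin m}
    {o : Fin T → Finset (Fin T × Fin m)} (h : o ∈ revealing θ) (h' : o ∈ revealing θ') :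
    θ = θ' := by
  funext t
  exact (h' t _).1 ((h t _).2 rfl)

theorem disjoint_stopEvent {S A O : Type*} {nx : S → List (A × Bool) → A ⊕ O} {D D' : Set O}
    (h : Disjoint D D') : Disjoint (⋃ k, stopEvent nx D k) (⋃ k, stopEvent nx D' k) := by
  rw [Set.disjoint_left]
  intro ω h1 h2
  obtain ⟨k, hk⟩ := Set.mem_iUnion.1 h1
  obtain ⟨k', hk'⟩ := Set.mem_iUnion.1 h2
  obtain ⟨o, ho, e⟩ := stopEvent_mono D (le_max_left k k') hk
  obtain ⟨o', ho', e'⟩ := stopEvent_mono D' (le_max_right k k') hk'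
  rw [e] at e'
  obtain rfl := Sum.inr.inj e'
  exact Set.disjoint_left.1 h ho ho'

/-- The transport inequalities of all hard instances together with the PAC guarantee bound the
expected number of samples in the worst hard instance. -/
theorem mul_log_le_of_expectedSamples_le {B d m : ℕ} [NeZero m] {ε δ M : ℝ} (hd : 1 ≤ d)
    (hB : 2 ≤ B) (hm : 2 ≤ m) (hε : 0 < ε) (hεB : 8 * ε * B = 1) (hδ : 0 < δ) (hδ' : δ ≤ 1 / 2)
    (alg : SamplingAlgorithm.{u} (Fin (B ^ d) × Fin m) d
      (Fin (B ^ d) → Finset (Fin (B ^ d) × Fin m)))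
    (halg : alg.AchievesPAC (singleCopy (B ^ d) m) ε δ) (hM : 0 ≤ M)
    (hle : ∀ θ, alg.expectedSamples (hardModel (d := d) (by omega) hε hεB θ) ≤
      ENNReal.ofReal M) :
    (B ^ d : ℕ) * ((m : ℝ) - 1) / 480 * Real.log ((B ^ d : ℕ) / δ) ≤ 165 * ε ^ 2 * M := by
  have hB' : (2 : ℝ) ≤ B := by exact_mod_cast hB
  have hm' : (2 : ℝ) ≤ m := by exact_mod_cast hm
  have hε' : ε ≤ 1 / 16 := by nlinarith
  have hT : (2 : ℝ) ≤ (B ^ d : ℕ) := by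
    exact_mod_cast hB.trans (Nat.le_self_pow (by omega) B)
  let out : Fin (B ^ d) × Fin m → Bool → Fin d → ℝ := hardOutcome B d ε
  have hout : ∀ a, Function.Injective (out a) := hardOutcome_injective hd ε
  let nx := coinStrategy alg out
  have hnx : ∀ l r, MeasurableSet {s | nx s l = r} := measurableSet_coinStrategy_eq alg out
  let G : (Fin (B ^ d) → Fin m) → Set (alg.Seed × (ℕ × (Fin (B ^ d) × Fin m) → Bool)) :=
    fun θ => ⋃ k, stopEvent nx (revealing θ) k
  let P : (Fin (B ^ d) → Fin m) → (Fin (B ^ d) → Fin m) → ℝ := fun θ' θ =>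
    (alg.seedLaw.prod (coinTable (hardBias ε θ'))).real (G θ)
  obtain ⟨hκ, hκ'⟩ := fairDivergence_bounds hε hε'
  have htop := coe_topBias hε hε'
  rw [← htop] at hκ hκ'
  have hcorrect : ∀ θ, 1 - δ ≤ P θ θ := by
    intro θ
    refine le_measure_stopEvent alg (hardModel (d := d) (by omega) hε hεB θ) _ (fun _ => rfl) hout
      _ _ ((halg _).trans (measure_mono fun ω hω => ?_))
    obtain ⟨o, ho, ho'⟩ := hω
    exact ⟨o, ho, fun t j => mem_iff_of_isEpsPareto hB hε hεB θ (ho' t) j⟩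
  have hsum : ∀ θ', ∑ θ, P θ' θ ≤ 1 := by
    intro θ'
    have hmeas : ∀ θ, MeasurableSet (G θ) := fun θ =>
      .iUnion fun k => measurableSet_stopEvent hnx (revealing θ) k
    have hdisj : ∀ θ θ'', θ ≠ θ'' → Disjoint (G θ) (G θ'') := fun θ θ'' hne =>
      disjoint_stopEvent (Set.disjoint_left.2 fun o h h' => hne (eq_of_mem_revealing h h'))
    exact (sum_measureReal_le_measureReal_univ (t := G) (s := Finset.univ)
      (fun θ _ => hmeas θ) fun θ _ θ'' _ hne => hdisj θ θ'' hne).trans measureReal_le_one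
  -- `y` bounds the averaged probability of the wrong event: `(m - 1) / 3 * δ` divided by the total
  -- weight `T * (m - 1) / 4`. Prior mass `1/4` on the arm `0` keeps `y ≤ 1/3`; mass `1/2` would
  -- allow `y = 1/2`, where the bound is void.
  set y : ℝ := 4 * δ / (3 * (B ^ d : ℕ)) with hy
  have hy0 : 0 < y := by positivity
  have hy1 : y ≤ 1 / 3 := by
    rw [hy, div_le_iff₀ (by positivity)]
    linarith
  -- `log K` is the log-odds weight that is optimal for comparing probability `1/2` with `y`, and `z
  -- = 1 + (K - 1) * y` is where the tangent is exact. Then `log K / 2 - log z` is the divergence of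
  -- a fair coin from one of bias `y`.
  set K : ℝ := (1 - y) / y with hKdef
  set z : ℝ := 2 * (1 - y) with hzdef
  have hz : 0 < z := by linarith
  have hK : 1 ≤ K := by
    rw [hKdef, le_div_iff₀ hy0]
    linarith
  have hstar : ∀ θ : Fin (B ^ d) → Fin m, ∑ a ∈ Finset.univ.filter
      (fun a : Fin (B ^ d) × Fin m => θ a.1 = 0 ∧ a.2 ≠ 0), (Real.log K * P θ θ -
        (K - 1) / z * P (Function.update θ a.1 a.2) θ - (Real.log z - 1 + 1 / z)) ≤
      165 * ε ^ 2 * M := by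
    intro θ
    have hE := expectedSamples_eq_lintegral alg (hardModel (d := d) (by omega) hε hεB θ) _
      (fun _ => rfl) hout
    have hlt := hle θ
    rw [hE] at hlt
    have h := sum_transport_limit_le alg.seedLaw hnx (hardBias ε θ)
      (Finset.univ.filter fun a : Fin (B ^ d) × Fin m => θ a.1 = 0 ∧ a.2 ≠ 0)
      (fun a ha => by
        obtain ⟨h1, h2⟩ := (Finset.mem_filter.1 ha).2
        rw [coe_hardBias hε hε']
        simp [hardShift, h1, h2])
      (topBias ε) (by rw [htop]; linarith) (by rw [htop]; linarith) hκ (revealing θ)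
      (K := K) (z := z) (by linarith) hz (ne_top_of_le_ne_top ENNReal.ofReal_ne_top hlt)
    have h' := ENNReal.toReal_mono ENNReal.ofReal_ne_top hlt
    rw [ENNReal.toReal_ofReal hM] at h'
    calc _ = _ := Finset.sum_congr rfl fun a ha => by
          obtain ⟨h1, h2⟩ := (Finset.mem_filter.1 ha).2
          simp only [P]
          rw [hardBias_update ε h1 h2]
      _ ≤ _ := h
      _ ≤ fairDivergence (topBias ε) * M := mul_le_mul_of_nonneg_left h' hκ
      _ ≤ _ := mul_le_mul_of_nonneg_right hκ' hM
  have havg := averaged_transport_le hm (Real.log_nonneg hK)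
    (div_nonneg (by linarith) hz.le : 0 ≤ (K - 1) / z) P (fun _ _ => measureReal_nonneg) hsum
    hcorrect hstar
  have hhalf : Real.log K * (1 / 2) ≤ Real.log K * (1 - δ) :=
    mul_le_mul_of_nonneg_left (by linarith) (Real.log_nonneg hK)
  have hδy : δ = 3 / 4 * (B ^ d : ℕ) * y := by
    rw [hy]
    field_simp
  have htan : (K - 1) / z * y + 1 / z = 1 := by
    have h1 : y ≠ 0 := hy0.ne'
    have h2 : 1 - y ≠ 0 := by linarith
    rw [hKdef, hzdef]
    field_simp
    ring
  have hlog : Real.log K * (1 / 2) - Real.log z = -(1 / 2) * Real.log (4 * y * (1 - y)) := by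
    have h2 : 1 - y ≠ 0 := by linarith
    rw [hKdef, hzdef, Real.log_div h2 hy0.ne', Real.log_mul two_ne_zero h2,
      Real.log_mul (by positivity) h2, Real.log_mul (by norm_num) hy0.ne',
      show (4 : ℝ) = 2 ^ 2 by norm_num, Real.log_pow]
    push_cast
    ring
  have hnum := log_inv_le_of_le_third hy0 hy1
  have hnum' := log_div_le hT hδ hδ'
  rw [← hy] at hnum'
  have hfac : 0 ≤ (B ^ d : ℕ) * ((m : ℝ) - 1) / 4 := by
    have : 0 ≤ (m : ℝ) - 1 := by linarith
    positivity
  -- The factor `1/120` is `1/2` from `hlog`, `1/30` from `hnum` and `1/2` from `hnum'`.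
  have hmain : (B ^ d : ℕ) * ((m : ℝ) - 1) / 4 * (1 / 120 * Real.log ((B ^ d : ℕ) / δ)) ≤
      (B ^ d : ℕ) * ((m : ℝ) - 1) / 4 * (Real.log K * (1 - δ) - (Real.log z - 1 + 1 / z) -
        (K - 1) / z * y) :=
    mul_le_mul_of_nonneg_left (by linarith) hfac
  have hrew : (K - 1) / z * (((m : ℝ) - 1) / 3 * δ) =
      (B ^ d : ℕ) * ((m : ℝ) - 1) / 4 * ((K - 1) / z * y) := by
    rw [hδy]
    ring
  rw [hrew] at havg
  linarith

end RangeSearch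

theorem mainTheorem6 :
    ∃ C : ℝ, 0 < C ∧
      ∀ (d B m : ℕ) (ε δ : ℝ), 1 ≤ d → 2 ≤ B → 2 ≤ m → 0 < ε → 1 / (8 * ε) = (B : ℝ) →
        0 < δ → δ ≤ 1 / 2 →
        ∀ alg : RangeSearch.SamplingAlgorithm.{u} (Fin (B ^ d) × Fin m) d
            (Fin (B ^ d) → Finset (Fin (B ^ d) × Fin m)),
          alg.AchievesPAC (RangeSearch.singleCopy (B ^ d) m) ε δ →
          ∃ (R : RangeSearch.RewardModel (Fin (B ^ d) × Fin m) d)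
            (s : Fin (B ^ d) → Fin m → ℝ) (c : Fin (B ^ d) → Fin m),
            (∀ t j i, R.weight (t, j) i = s t j + 4 * ε * (RangeSearch.digit B d t i : ℝ)) ∧
            (∀ t j, 1 / 4 ≤ s t j ∧ s t j ≤ 1 / 4 + 4 * ε) ∧
            (∀ t j, j ≠ c t → s t j + ε < s t (c t)) ∧
            (∀ t' t j, t' < t → ¬ RangeSearch.EpsDominates R.weight ε (t', j) (t, c t)) ∧
            ENNReal.ofReal
                (C * (((m * B ^ d : ℕ) : ℝ) / ε ^ 2 * Real.log (1 / (ε ^ d * δ)))) ≤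
              alg.expectedSamples R := by
  refine ⟨1 / 10 ^ 6, by norm_num, ?_⟩
  intro d B m ε δ hd hB hm hε hB1 hδ hδ' alg halg
  have : NeZero m := ⟨by omega⟩
  have hεB : 8 * ε * B = 1 := by
    rw [← hB1]
    field_simp
  suffices h : ∃ θ, ENNReal.ofReal
      (1 / 10 ^ 6 * (((m * B ^ d : ℕ) : ℝ) / ε ^ 2 * Real.log (1 / (ε ^ d * δ)))) ≤
      alg.expectedSamples (RangeSearch.hardModel (d := d) (by omega) hε hεB θ) by
    obtain ⟨θ, hθ⟩ := h
    refine ⟨RangeSearch.hardModel (by omega) hε hεB θ,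
      fun t j => 1 / 4 + RangeSearch.hardShift ε θ (t, j), θ, fun t j i => ?_, fun t j => ?_,
      fun t j hj => ?_, fun t' t j h => ?_, hθ⟩
    · exact RangeSearch.weight_hardModel hB hε hεB θ (t, j) i
    · have := RangeSearch.hardShift_mem hε θ (t, j)
      constructor <;> linarith
    · have := RangeSearch.hardShift_gap hε θ t hj
      linarith
    · exact RangeSearch.not_epsDominates_hardModel hB hε hεB θ h j
  by_contra! hlt
  have hm' : (2 : ℝ) ≤ m := by exact_mod_cast hm
  have hT : (2 : ℝ) ≤ (B ^ d : ℕ) := by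
    exact_mod_cast hB.trans (Nat.le_self_pow (by omega) B)
  have hacc := RangeSearch.log_accuracy_le (d := d) hB hε hεB hδ hδ'
  have hpos : 0 < Real.log (1 / (ε ^ d * δ)) := by
    have hB' : (2 : ℝ) ≤ B := by exact_mod_cast hB
    refine Real.log_pos ((one_lt_div (by positivity)).2 ?_)
    have : ε ^ d ≤ 1 := pow_le_one₀ hε.le (by nlinarith)
    nlinarith
  have h := RangeSearch.mul_log_le_of_expectedSamples_le hd hB hm hε hεB hδ hδ' alg halg
    (by positivity) fun θ => (hlt θ).le
  rw [Nat.cast_mul] at h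
  set L := Real.log (1 / (ε ^ d * δ))
  set T : ℝ := ((B ^ d : ℕ) : ℝ)
  have hX : 165 * ε ^ 2 * (1 / 10 ^ 6 * (m * T / ε ^ 2 * L)) = 165 / 10 ^ 6 * (m * T * L) := by
    field_simp
  rw [hX] at h
  -- With `m - 1 ≥ m / 2` the lower bound is `m * T * L / 3840`, which exceeds the assumed `165 / 10
  -- ^ 6 * (m * T * L)`.
  have h1 : T * (m / 2) / 480 * (L / 4) ≤ T * ((m : ℝ) - 1) / 480 * Real.log (T / δ) := by
    refine mul_le_mul ?_ (by linarith) (by positivity) ?_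
    · have : T * ((m : ℝ) / 2) ≤ T * (m - 1) := mul_le_mul_of_nonneg_left (by linarith) (by linarith)
      linarith
    · have : 0 ≤ (m : ℝ) - 1 := by linarith
      positivity
  have h2 : 0 < m * T * L := by positivity
  nlinarith
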